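/- Let $1\le k<k'\le n-1$ be integers. Let $G_{n,k}$ be the Grassmann manifold of all $k$-dimensional linear subspaces of $\mathbb{R}^n$ with its $O(n)$-invariant probability measure $d\xi$, and let $G(n,k)$ be the set of all $k$-dimensional affine planes in $\mathbb{R}^n$; each such plane is written as $\tau(\xi,u)=\xi+u$ with $\xi\in G_{n,k}$, $u\in\xi^\perp$. For $\eta\in G_{n,k'}$ let $d_\eta\xi$ be the $O(\eta)$-invariant probability measure on the set of all $k$-dimensional linear subspaces $\xi\subset\eta$. A function $f:G(n,k)\to\mathbb{C}$ is called quasi-radial if $f(\xi,u)=f_0(\xi,|u|)$ for some function $f_0$ and all $\xi\in G_{n,k}$, $u\in\xi^\perp$; quasi-radial functions on $G(n,k')$ are defined in the same way. The Radon transform of $f$ is the function on $G(n,k')$ given by $$(Rf)(\eta,v)=\int_{\xi\subset\eta}d_\eta\xi\int_{\xi^\perp\cap\eta}f(\xi,v+x)\,dx,\qquad \eta\in G_{n,k'},\ v\in\eta^\perp .$$ Let $f(\xi,u)=f_0(\xi,|u|)$ be a quasi-radial function on $G(n,k)$, with $f_0$ measurable on $G_{n,k}\times(0,\infty)$, such that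 $$\int_{G_{n,k}}d\xi\int_a^\infty|f_0(\xi,r)|\,r^{k'-k-1}\,dr<\infty\qquad\text{for all } a>0 .$$ Then the integral $(Rf)(\eta,v)$ exists in the Lebesgue sense (that is, it is finite when $f$ is replaced by $|f|$) for almost all $\eta\in G_{n,k'}$ and almost all $v\in\eta^\perp$, and $\varphi=Rf$ is quasi-radial. Moreover, if $\varphi(\eta,v)=\varphi_0(\eta,|v|)$, then $$\varphi_0(\eta,s)=\int_{\xi\subset\eta}g_\xi(s)\,d_\eta\xi,\qquad g_\xi(s)=\sigma_{k'-k-1}\int_s^\infty f_0(\xi,r)\,(r^2-s^2)^{(k'-k)/2-1}\,r\,dr,$$ where $\sigma_{d-1}=2\pi^{d/2}/\Gamma(d/2)$ is the area of the unit sphere in $\mathbb{R}^d$; for every $\eta\in G_{n,k'}$ and $v\in\eta^\perp$, the iterated integral on the right-hand side with $s=|v|$ exists in the Lebesgue sense if and only if $(Rf)(\eta,v)$ does. (Where an integral does not exist in the Lebesgue sense, it is assigned the value $0$, the inner integrals being treated first; with this convention the formula holds for all $\eta\in G_{n,k'}$ and $s\ge0$.) -/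

import Mathlib

open MeasureTheory Set
open scoped ENNReal

noncomputable section

/-! ### The Grassmannian of `k`-dimensional linear subspaces -/

/-- The set of all `k`-dimensional linear subspaces of the Euclidean space `V`. -/
def Gr (V : Type*) [NormedAddCommGroup V] [InnerProductSpace ℝ V] (k : ℕ) : Type _ :=
  {ξ : Submodule ℝ V // Module.finrank ℝ ξ = k}

namespace Gr

/-- The usual topology of the Grassmannian: subspaces are identified with the orthogonal
projections onto them. -/
instance topologicalSpace (V : Type*) [NormedAddCommGroup V] [InnerProductSpace ℝ V]
    [FiniteDimensional ℝ V] (k : ℕ) : TopologicalSpace (Gr V k) :=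
  TopologicalSpace.induced (fun ξ => (ξ.1.starProjection : V →L[ℝ] V)) inferInstance

instance measurableSpace (V : Type*) [NormedAddCommGroup V] [InnerProductSpace ℝ V]
    [FiniteDimensional ℝ V] (k : ℕ) : MeasurableSpace (Gr V k) := borel _

instance borelSpace (V : Type*) [NormedAddCommGroup V] [InnerProductSpace ℝ V]
    [FiniteDimensional ℝ V] (k : ℕ) : BorelSpace (Gr V k) := ⟨rfl⟩

/-- The image of a `k`-dimensional subspace under a linear isometry. -/
def map {V W : Type*} [NormedAddCommGroup V] [InnerProductSpace ℝ V] [NormedAddCommGroup W]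
    [InnerProductSpace ℝ W] {k : ℕ} (L : V →ₗᵢ[ℝ] W) (ξ : Gr V k) : Gr W k :=
  ⟨ξ.1.map L.toLinearMap,
    (Submodule.equivMapOfInjective L.toLinearMap L.injective ξ.1).finrank_eq.symm.trans ξ.2⟩

end Gr

/-- The orthogonal group `O(V)`. -/
abbrev OrthGroup (V : Type*) [NormedAddCommGroup V] [InnerProductSpace ℝ V]
    [FiniteDimensional ℝ V] : Type _ := unitary (V →L[ℝ] V)

instance OrthGroup.compactSpace (V : Type*) [NormedAddCommGroup V] [InnerProductSpace ℝ V]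
    [FiniteDimensional ℝ V] : CompactSpace (OrthGroup V) := by
  refine isCompact_iff_compactSpace.mp ?_
  have : ProperSpace (V →L[ℝ] V) := FiniteDimensional.proper_real _
  refine Metric.isCompact_of_isClosed_isBounded isClosed_unitary ?_
  refine (Metric.isBounded_closedBall (x := (0 : V →L[ℝ] V)) (r := 1)).subset ?_
  intro u hu
  rw [mem_closedBall_zero_iff]
  refine ContinuousLinearMap.opNorm_le_bound _ zero_le_one fun x => ?_
  rw [one_mul]
  exact (Unitary.norm_map ⟨u, hu⟩ x).le

/-- The Haar probability measure of `O(V)`. -/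
def orthHaar (V : Type*) [NormedAddCommGroup V] [InnerProductSpace ℝ V] [FiniteDimensional ℝ V] :
    Measure (OrthGroup V) := Measure.haarMeasure ⊤

open Classical in
/-- The `O(V)`-invariant probability measure `dξ` on the Grassmannian of `k`-dimensional subspaces
of `V`, `k ≤ dim V`: the law of `g ξ₀`, where `g` is distributed over `O(V)` by the Haar probability
measure and `ξ₀` is a fixed `k`-dimensional subspace (the choice of `ξ₀` does not matter, as `O(V)`
acts transitively). For `k > dim V` the Grassmannian is empty. -/
def grMeasure (V : Type*) [NormedAddCommGroup V] [InnerProductSpace ℝ V] [FiniteDimensional ℝ V]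
    (k : ℕ) : Measure (Gr V k) :=
  if h : Nonempty (Gr V k) then
    (orthHaar V).map fun g => Gr.map (Unitary.linearIsometryEquiv g).toLinearIsometry h.some
  else 0

/-- The canonical probability measure `d_η ξ` on the set of all `k`-dimensional subspaces `ξ ⊂ η`,
as a measure on the Grassmannian of `V` that lives on these subspaces: the image of the
`O(η)`-invariant probability measure on the Grassmannian of `η`. -/
def subGrMeasure {V : Type*} [NormedAddCommGroup V] [InnerProductSpace ℝ V] [FiniteDimensional ℝ V]
    {m : ℕ} (k : ℕ) (η : Gr V m) : Measure (Gr V k) :=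
  (grMeasure η.1 k).map (Gr.map η.1.subtypeₗᵢ)

/-! ### The affine Grassmannian -/

/-- The set of all `k`-dimensional affine planes in `V`. -/
def AffGr (V : Type*) [NormedAddCommGroup V] [InnerProductSpace ℝ V] (k : ℕ) : Type _ :=
  {τ : AffineSubspace ℝ V // (τ : Set V).Nonempty ∧ Module.finrank ℝ τ.direction = k}

namespace AffGr

/-- The plane `τ(ξ, u) = ξ + u`. -/
def mk {V : Type*} [NormedAddCommGroup V] [InnerProductSpace ℝ V] {k : ℕ}
    (ξ : Gr V k) (u : V) : AffGr V k :=
  ⟨AffineSubspace.mk' u ξ.1, AffineSubspace.mk'_nonempty u ξ.1, by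
    rw [AffineSubspace.direction_mk']
    exact ξ.2⟩

/-- The linear subspace `ξ` parallel to the plane `τ = ξ + u`. -/
def dir {V : Type*} [NormedAddCommGroup V] [InnerProductSpace ℝ V] {k : ℕ}
    (τ : AffGr V k) : Gr V k := ⟨τ.1.direction, τ.2.2⟩

/-- The point `u ∈ ξ^⊥` of the plane `τ = ξ + u`, that is, its point nearest to the origin. -/
def foot {V : Type*} [NormedAddCommGroup V] [InnerProductSpace ℝ V] [FiniteDimensional ℝ V] {k : ℕ}
    (τ : AffGr V k) : V :=
  haveI : Nonempty τ.1 := τ.2.1.to_subtype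
  (EuclideanGeometry.orthogonalProjection τ.1 (0 : V) : V)

end AffGr

/-- `f(ξ, u) = f₀(ξ, |u|)` for all `k`-dimensional `ξ` and all `u ∈ ξ^⊥`. -/
def HasRadialProfile {V : Type*} [NormedAddCommGroup V] [InnerProductSpace ℝ V] {k : ℕ}
    (f : AffGr V k → ℂ) (f₀ : Gr V k → ℝ → ℂ) : Prop :=
  ∀ ξ : Gr V k, ∀ u ∈ Submodule.orthogonal ξ.1, f (AffGr.mk ξ u) = f₀ ξ ‖u‖

/-- Quasi-radial functions on the affine Grassmannian. -/
def QuasiRadial {V : Type*} [NormedAddCommGroup V] [InnerProductSpace ℝ V] {k : ℕ}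
    (f : AffGr V k → ℂ) : Prop :=
  ∃ f₀ : Gr V k → ℝ → ℂ, HasRadialProfile f f₀

/-! ### The Radon transform -/

/-- The integral `∫ dν(x) ∫ F(x, y) dm_x(y)` exists in the Lebesgue sense, that is, it is finite
when `F` is replaced by `|F|`. -/
def IteratedIntegrable {X : Type*} [MeasurableSpace X] {Y : X → Type*}
    [∀ x, MeasurableSpace (Y x)] (ν : Measure X) (m : ∀ x, Measure (Y x))
    (F : ∀ x, Y x → ℂ) : Prop :=
  (∀ᵐ x ∂ν, Integrable (F x) (m x)) ∧
    Integrable (fun x => ∫ y, ‖F x y‖ ∂(m x)) ν ∧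
    AEStronglyMeasurable (fun x => ∫ y, F x y ∂(m x)) ν

/-- The Radon transform
`(Rf)(η, v) = ∫_{ξ ⊂ η} d_η ξ ∫_{ξ^⊥ ∩ η} f(ξ, v + x) dx`, as a function of the `m`-plane
`ζ = η + v`. -/
def radon {V : Type*} [NormedAddCommGroup V] [InnerProductSpace ℝ V] [FiniteDimensional ℝ V]
    [MeasurableSpace V] [BorelSpace V] {k : ℕ} (m : ℕ) (f : AffGr V k → ℂ) (ζ : AffGr V m) : ℂ :=
  ∫ ξ, (∫ x : ↥(Submodule.orthogonal ξ.1 ⊓ ζ.dir.1), f (AffGr.mk ξ (ζ.foot + (x : V))))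
    ∂(subGrMeasure k ζ.dir)

/-- The integral that defines `(Rf)(ζ)` exists in the Lebesgue sense. -/
def RadonExists {V : Type*} [NormedAddCommGroup V] [InnerProductSpace ℝ V] [FiniteDimensional ℝ V]
    [MeasurableSpace V] [BorelSpace V] {k m : ℕ} (f : AffGr V k → ℂ) (ζ : AffGr V m) : Prop :=
  IteratedIntegrable (subGrMeasure k ζ.dir)
    (fun ξ : Gr V k => (volume : Measure ↥(Submodule.orthogonal ξ.1 ⊓ ζ.dir.1)))
    (fun ξ x => f (AffGr.mk ξ (ζ.foot + (x : V))))

/-- The area `σ_{d-1} = 2 π^{d/2} / Γ(d/2)` of the unit sphere of `ℝᵈ`. -/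
def sphereArea (d : ℕ) : ℝ := 2 * Real.pi ^ ((d : ℝ) / 2) / Real.Gamma ((d : ℝ) / 2)

/-- The integrand `f₀(ξ, r) (r² - s²)^{d/2 - 1} r`. -/
def radialIntegrand {V : Type*} [NormedAddCommGroup V] [InnerProductSpace ℝ V] {k : ℕ}
    (d : ℕ) (f₀ : Gr V k → ℝ → ℂ) (s : ℝ) (ξ : Gr V k) (r : ℝ) : ℂ :=
  f₀ ξ r * (((r ^ 2 - s ^ 2) ^ ((d : ℝ) / 2 - 1) * r : ℝ) : ℂ)

/-- `g_ξ(s) = σ_{d-1} ∫_s^∞ f₀(ξ, r) (r² - s²)^{d/2 - 1} r dr`. -/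
def radialTransform {V : Type*} [NormedAddCommGroup V] [InnerProductSpace ℝ V] {k : ℕ}
    (d : ℕ) (f₀ : Gr V k → ℝ → ℂ) (s : ℝ) (ξ : Gr V k) : ℂ :=
  (sphereArea d : ℂ) * ∫ r in Ioi s, radialIntegrand d f₀ s ξ r

end

/-! Put d = k' - k. If ξ ⊂ η and v ∈ η^⊥, then every x ∈ ξ^⊥ ∩ η is orthogonal to v, so |v + x|² =
|v|² + |x|². The inner integral of `radon` is therefore the integral of a radial function over a
d-dimensional Euclidean space. Polar coordinates and the substitution r² = |v|² + |x|² turn it into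
g_ξ(|v|); the same holds for |f| and for integrability itself (`integrable_radial_iff`,
`integral_radial`). Since d_η ξ lives on the ξ ⊂ η, this yields the formula, quasi-radiality and the
equivalence of existence at every single plane, without any assumption on the size of f₀; divergent
integrals take the value 0 on both sides.

Existence almost everywhere uses two averaging arguments. The measures d_η ξ average to dξ over η
(`lintegral_lintegral_subGrMeasure_rotate`), so for almost every η the hypothesis holds with d_η ξ
in place of dξ. For such η, the kernel (r² - s²)^(d/2-1) r is integrated over s > a against the
weight s⁻². The result is at most r^(d-1)/a, so Tonelli makes the Abel-type integral finite for
almost every s > a (`ae_lintegral_lintegral_kernel_lt_top`). Letting a → 0 and using polar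
coordinates in η^⊥ gives almost every v.

The existence predicate is not shown to be measurable in η. Almost-everywhere statements are proved
on the orthogonal group and pushed forward by `ae_map_of_ae_of_continuous`. -/

/-! ### The action of the orthogonal group on the Grassmannian -/

section Action

variable {V W : Type*} [NormedAddCommGroup V] [InnerProductSpace ℝ V] [FiniteDimensional ℝ V]
  [NormedAddCommGroup W] [InnerProductSpace ℝ W] [FiniteDimensional ℝ W]

namespace Gr

/-- The action of the orthogonal group on the Grassmannian. -/
noncomputable def rotate {k : ℕ} (g : OrthGroup V) (ξ : Gr V k) : Gr V k :=
  Gr.map (Unitary.linearIsometryEquiv g).toLinearIsometry ξ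

theorem continuous_starProjection (k : ℕ) :
    Continuous fun ξ : Gr V k => (ξ.1.starProjection : V →L[ℝ] V) :=
  continuous_induced_dom

theorem starProjection_injective (k : ℕ) :
    Function.Injective fun ξ : Gr V k => (ξ.1.starProjection : V →L[ℝ] V) := by
  intro ξ ζ h
  apply Subtype.ext
  have := congrArg (fun T : V →L[ℝ] V => LinearMap.range T.toLinearMap) h
  simpa using this

theorem isEmbedding_starProjection (k : ℕ) :
    Topology.IsEmbedding fun ξ : Gr V k => (ξ.1.starProjection : V →L[ℝ] V) :=
  ⟨⟨rfl⟩, starProjection_injective k⟩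

instance secondCountableTopology (k : ℕ) : SecondCountableTopology (Gr V k) :=
  (isEmbedding_starProjection k).secondCountableTopology

instance t2Space (k : ℕ) : T2Space (Gr V k) :=
  (isEmbedding_starProjection k).t2Space

/-- The topology is induced by projections, so this formula reduces continuity of the action to
continuity of composition and adjoint. -/
theorem starProjection_map (L : V →ₗᵢ[ℝ] W) {k : ℕ} (ξ : Gr V k) :
    (Gr.map L ξ).1.starProjection = L.toContinuousLinearMap ∘L ξ.1.starProjection ∘L
      ContinuousLinearMap.adjoint L.toContinuousLinearMap := by
  ext x
  apply Submodule.eq_starProjection_of_mem_orthogonal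
  · exact Submodule.mem_map_of_mem (Submodule.starProjection_apply_mem _ _)
  · rw [Submodule.mem_orthogonal]
    rintro _ ⟨y, hy, rfl⟩
    have h1 : inner ℝ (L y) x =
        inner ℝ y (ContinuousLinearMap.adjoint L.toContinuousLinearMap x) :=
      (ContinuousLinearMap.adjoint_inner_right L.toContinuousLinearMap y x).symm
    have h2 := (Submodule.mem_orthogonal _ _).1 (Submodule.sub_starProjection_mem_orthogonal
      (K := ξ.1) (ContinuousLinearMap.adjoint L.toContinuousLinearMap x)) y hy
    rw [inner_sub_right] at h2 ⊢
    simp only [LinearIsometry.coe_toLinearMap, ContinuousLinearMap.comp_apply,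
      LinearIsometry.coe_toContinuousLinearMap, LinearIsometry.inner_map_map]
    rw [h1]
    exact h2

theorem continuous_map (L : V →ₗᵢ[ℝ] W) (k : ℕ) : Continuous (Gr.map (k := k) L) := by
  rw [(isEmbedding_starProjection (V := W) k).continuous_iff]
  simp only [Function.comp_def, starProjection_map]
  exact continuous_const.clm_comp ((continuous_starProjection k).clm_comp continuous_const)

theorem continuous_rotate (k : ℕ) :
    Continuous fun p : OrthGroup V × Gr V k => rotate p.1 p.2 := by
  rw [(isEmbedding_starProjection (V := V) k).continuous_iff]
  simp only [Function.comp_def, rotate, starProjection_map]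
  have h : Continuous fun p : OrthGroup V × Gr V k => (p.1 : V →L[ℝ] V) := by fun_prop
  exact h.clm_comp (((continuous_starProjection k).comp continuous_snd).clm_comp
    (ContinuousLinearMap.adjoint.continuous.comp h))

theorem measurable_map (L : V →ₗᵢ[ℝ] W) (k : ℕ) : Measurable (Gr.map (k := k) L) :=
  (continuous_map L k).measurable

theorem measurable_rotate (k : ℕ) :
    Measurable fun p : OrthGroup V × Gr V k => rotate p.1 p.2 :=
  (continuous_rotate k).measurable

theorem map_map {V W U : Type*} [NormedAddCommGroup V] [InnerProductSpace ℝ V]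
    [NormedAddCommGroup W] [InnerProductSpace ℝ W] [NormedAddCommGroup U] [InnerProductSpace ℝ U]
    {k : ℕ} (M : W →ₗᵢ[ℝ] U) (L : V →ₗᵢ[ℝ] W) (ξ : Gr V k) :
    Gr.map M (Gr.map L ξ) = Gr.map (M.comp L) ξ :=
  Subtype.ext (Submodule.map_comp L.toLinearMap M.toLinearMap ξ.1).symm

theorem rotate_mul {k : ℕ} (g h : OrthGroup V) (ξ : Gr V k) :
    rotate (g * h) ξ = rotate g (rotate h ξ) := by
  rw [rotate, rotate, rotate, map_map]
  rfl

/-- Matching orthonormal bases gives an isometry between the two subspaces, which extends to all of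
V by finite dimension. -/
theorem exists_rotate_eq {k : ℕ} (ξ ζ : Gr V k) : ∃ g : OrthGroup V, rotate g ξ = ζ := by
  let e : ξ.1 ≃ₗᵢ[ℝ] ζ.1 :=
    (stdOrthonormalBasis ℝ ξ.1).equiv (stdOrthonormalBasis ℝ ζ.1)
      (finCongr (ξ.2.trans ζ.2.symm))
  let L : ξ.1 →ₗᵢ[ℝ] V := ζ.1.subtypeₗᵢ.comp e.toLinearIsometry
  let E : V ≃ₗᵢ[ℝ] V := L.extend.toLinearIsometryEquiv rfl
  refine ⟨Unitary.linearIsometryEquiv.symm E, ?_⟩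
  have hE : ∀ x : ξ.1, E x = (e x : V) := fun x => L.extend_apply x
  apply Subtype.ext
  ext y
  rw [rotate, MulEquiv.apply_symm_apply]
  constructor
  · rintro ⟨x, hx, rfl⟩
    have := hE ⟨x, hx⟩
    change E x ∈ ζ.1
    rw [this]
    exact (e ⟨x, hx⟩).2
  · intro hy
    refine ⟨e.symm ⟨y, hy⟩, (e.symm ⟨y, hy⟩).2, ?_⟩
    change E (e.symm ⟨y, hy⟩ : V) = y
    rw [hE, e.apply_symm_apply]

end Gr

/-! ### Invariant measures -/

instance orthHaar.isHaarMeasure : (orthHaar V).IsHaarMeasure := by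
  unfold orthHaar; infer_instance

instance orthHaar.isProbabilityMeasure : IsProbabilityMeasure (orthHaar V) :=
  ⟨by
    have := Measure.haarMeasure_self (K₀ := (⊤ : TopologicalSpace.PositiveCompacts (OrthGroup V)))
    simpa [orthHaar] using this⟩

/-- A right translate is again a Haar probability measure, hence the same one by uniqueness. -/
instance orthHaar.isMulRightInvariant : (orthHaar V).IsMulRightInvariant :=
  ⟨fun g => by
    have : IsProbabilityMeasure ((orthHaar V).map (· * g)) :=
      Measure.isProbabilityMeasure_map (measurable_mul_const g).aemeasurable
    exact Measure.isHaarMeasure_eq_of_isProbabilityMeasure _ _⟩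

theorem measurable_rotate_left {k : ℕ} (ξ : Gr V k) :
    Measurable fun g : OrthGroup V => Gr.rotate g ξ :=
  (Gr.measurable_rotate k).comp measurable_prodMk_right

theorem measurable_rotate_right {k : ℕ} (g : OrthGroup V) :
    Measurable (Gr.rotate g : Gr V k → Gr V k) :=
  (Gr.measurable_rotate k).comp measurable_prodMk_left

/-- By transitivity, a change of base point is a right translation on the group, which the Haar
measure absorbs. -/
theorem grMeasure_eq_map {k : ℕ} (ξ : Gr V k) :
    grMeasure V k = (orthHaar V).map fun g => Gr.rotate g ξ := by
  have h : Nonempty (Gr V k) := ⟨ξ⟩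
  rw [grMeasure, dif_pos h]
  obtain ⟨a, ha⟩ := Gr.exists_rotate_eq ξ h.some
  change (orthHaar V).map (fun g => Gr.rotate g h.some) = _
  rw [← ha]
  simp_rw [← Gr.rotate_mul]
  conv_rhs => rw [← map_mul_right_eq_self (orthHaar V) a]
  rw [Measure.map_map (measurable_rotate_left ξ) (measurable_mul_const a)]
  rfl

theorem isProbabilityMeasure_grMeasure {k : ℕ} (ξ : Gr V k) :
    IsProbabilityMeasure (grMeasure V k) := by
  rw [grMeasure_eq_map ξ]
  exact Measure.isProbabilityMeasure_map (measurable_rotate_left ξ).aemeasurable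

theorem map_rotate_grMeasure {k : ℕ} (g : OrthGroup V) :
    (grMeasure V k).map (Gr.rotate g) = grMeasure V k := by
  by_cases h : Nonempty (Gr V k)
  · obtain ⟨ξ⟩ := h
    rw [grMeasure_eq_map ξ, Measure.map_map (measurable_rotate_right g) (measurable_rotate_left ξ)]
    conv_rhs => rw [← map_mul_left_eq_self (orthHaar V) g]
    rw [Measure.map_map (measurable_rotate_left ξ) (measurable_const_mul g)]
    simp only [Function.comp_def, Gr.rotate_mul]
  · simp [grMeasure, h]

instance grMeasure.isFiniteMeasure (k : ℕ) : IsFiniteMeasure (grMeasure V k) := by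
  by_cases h : Nonempty (Gr V k)
  · have := isProbabilityMeasure_grMeasure h.some
    infer_instance
  · simp only [grMeasure, h, dite_false]
    infer_instance

/-- Averaging over the orthogonal group turns every probability measure on the Grassmannian into
the invariant one. -/
theorem lintegral_lintegral_rotate {k : ℕ} (μ : Measure (Gr V k)) [IsProbabilityMeasure μ]
    {F : Gr V k → ℝ≥0∞} (hF : Measurable F) :
    ∫⁻ g, ∫⁻ ξ, F (Gr.rotate g ξ) ∂μ ∂(orthHaar V) = ∫⁻ ξ, F ξ ∂(grMeasure V k) := by
  have hm : Measurable (Function.uncurry fun (g : OrthGroup V) (ξ : Gr V k) =>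
      F (Gr.rotate g ξ)) := hF.comp (Gr.measurable_rotate k)
  -- With the average over g taken first, the inner integral no longer depends on ξ, and μ
  -- contributes only its total mass 1.
  rw [lintegral_lintegral_swap hm.aemeasurable]
  have : ∀ ξ : Gr V k, ∫⁻ g, F (Gr.rotate g ξ) ∂(orthHaar V) = ∫⁻ ζ, F ζ ∂(grMeasure V k) := by
    intro ξ
    rw [grMeasure_eq_map ξ, lintegral_map hF (measurable_rotate_left ξ)]
  simp [this]

/-- The invariant probability measure on the Grassmannian is unique. -/
theorem eq_grMeasure_of_map_rotate {k : ℕ} (μ : Measure (Gr V k)) [IsProbabilityMeasure μ]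
    (hμ : ∀ g : OrthGroup V, μ.map (Gr.rotate g) = μ) : μ = grMeasure V k := by
  refine Measure.ext_of_lintegral _ fun F hF => ?_
  rw [← lintegral_lintegral_rotate μ hF]
  have : ∀ g : OrthGroup V, ∫⁻ ξ, F (Gr.rotate g ξ) ∂μ = ∫⁻ ξ, F ξ ∂μ := fun g => by
    conv_rhs => rw [← hμ g]
    rw [lintegral_map hF (measurable_rotate_right g)]
  simp [this]

theorem map_grMeasure_linearIsometryEquiv (e : V ≃ₗᵢ[ℝ] W) {k : ℕ} (hk : Nonempty (Gr V k)) :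
    (grMeasure V k).map (Gr.map e.toLinearIsometry) = grMeasure W k := by
  obtain ⟨ξ⟩ := hk
  have := isProbabilityMeasure_grMeasure ξ
  have : IsProbabilityMeasure ((grMeasure V k).map (Gr.map e.toLinearIsometry)) :=
    Measure.isProbabilityMeasure_map (Gr.measurable_map _ k).aemeasurable
  refine eq_grMeasure_of_map_rotate _ fun g => ?_
  -- The conjugate e⁻¹ g e: rotating by g after e is e after rotating by h.
  let h : OrthGroup V := Unitary.linearIsometryEquiv.symm
    ((e.trans (Unitary.linearIsometryEquiv g)).trans e.symm)
  rw [Measure.map_map (measurable_rotate_right g) (Gr.measurable_map _ k)]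
  conv_rhs => rw [← map_rotate_grMeasure h]
  rw [Measure.map_map (Gr.measurable_map _ k) (measurable_rotate_right h)]
  congr 1
  funext ζ
  simp only [Function.comp_def, Gr.rotate, Gr.map_map, h, MulEquiv.apply_symm_apply]
  congr 1
  ext x
  simp

theorem Gr.nonempty_of_le {k : ℕ} (hk : k ≤ Module.finrank ℝ V) : Nonempty (Gr V k) := by
  have hli : LinearIndependent ℝ (Module.finBasis ℝ V ∘ Fin.castLE hk) :=
    (Module.finBasis ℝ V).linearIndependent.comp _ (Fin.castLE_injective hk)
  exact ⟨⟨Submodule.span ℝ (range (Module.finBasis ℝ V ∘ Fin.castLE hk)), by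
    rw [finrank_span_eq_card hli, Fintype.card_fin]⟩⟩

/-! ### The measures d_η ξ: equivariance, support and disintegration. -/

theorem isProbabilityMeasure_subGrMeasure {k m : ℕ} (hkm : k ≤ m) (η : Gr V m) :
    IsProbabilityMeasure (subGrMeasure k η) := by
  obtain ⟨ξ⟩ : Nonempty (Gr η.1 k) := Gr.nonempty_of_le (η.2.symm ▸ hkm)
  have := isProbabilityMeasure_grMeasure ξ
  exact Measure.isProbabilityMeasure_map (Gr.measurable_map _ k).aemeasurable

/-- The rotation g restricts to an isometry from η onto gη, and such isometries carry one invariant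
measure to the other. -/
theorem subGrMeasure_rotate {k m : ℕ} (hkm : k ≤ m) (η : Gr V m) (g : OrthGroup V) :
    subGrMeasure k (Gr.rotate g η) = (subGrMeasure k η).map (Gr.rotate g) := by
  have hne : Nonempty (Gr η.1 k) := Gr.nonempty_of_le (η.2.symm ▸ hkm)
  let e : η.1 ≃ₗᵢ[ℝ] (Gr.rotate g η).1 := (Unitary.linearIsometryEquiv g).submoduleMap η.1
  rw [subGrMeasure, ← map_grMeasure_linearIsometryEquiv e hne, subGrMeasure,
    Measure.map_map (Gr.measurable_map _ k) (Gr.measurable_map _ k),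
    Measure.map_map (measurable_rotate_right g) (Gr.measurable_map _ k)]
  congr 1
  funext ζ
  change Gr.map _ (Gr.map _ ζ) = Gr.map _ (Gr.map _ ζ)
  rw [Gr.map_map, Gr.map_map]
  rfl

/-- The inclusion is the closed condition P_η P_ξ = P_ξ on projections. -/
theorem isClosed_setOf_le {m : ℕ} (k : ℕ) (η : Gr V m) : IsClosed {ξ : Gr V k | ξ.1 ≤ η.1} := by
  have : {ξ : Gr V k | ξ.1 ≤ η.1} =
      {ξ : Gr V k | η.1.starProjection ∘L ξ.1.starProjection = ξ.1.starProjection} := by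
    ext ξ
    constructor
    · intro h
      ext x
      exact Submodule.starProjection_eq_self_iff.2 (h (Submodule.starProjection_apply_mem _ _))
    · intro h x hx
      have := congrArg (fun T : V →L[ℝ] V => T x) h
      simp only [ContinuousLinearMap.comp_apply, Submodule.starProjection_eq_self_iff.2 hx] at this
      exact Submodule.starProjection_eq_self_iff.1 this
  rw [this]
  exact isClosed_eq (continuous_const.clm_comp (Gr.continuous_starProjection k))
    (Gr.continuous_starProjection k)

theorem ae_le_subGrMeasure {m : ℕ} (k : ℕ) (η : Gr V m) :
    ∀ᵐ ξ ∂(subGrMeasure k η), ξ.1 ≤ η.1 := by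
  rw [subGrMeasure, ae_map_iff (Gr.measurable_map _ k).aemeasurable
    (isClosed_setOf_le k η).measurableSet]
  refine .of_forall fun ζ => ?_
  rintro _ ⟨y, -, rfl⟩
  exact y.2

/-- The measures `d_η ξ` disintegrate the invariant measure `dξ`. -/
theorem lintegral_lintegral_subGrMeasure_rotate {k m : ℕ} (hkm : k ≤ m) (η : Gr V m)
    {F : Gr V k → ℝ≥0∞} (hF : Measurable F) :
    ∫⁻ g, ∫⁻ ξ, F ξ ∂(subGrMeasure k (Gr.rotate g η)) ∂(orthHaar V) =
      ∫⁻ ξ, F ξ ∂(grMeasure V k) := by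
  have := isProbabilityMeasure_subGrMeasure hkm η
  rw [← lintegral_lintegral_rotate (subGrMeasure k η) hF]
  refine lintegral_congr fun g => ?_
  rw [subGrMeasure_rotate hkm, lintegral_map hF (measurable_rotate_right g)]

theorem measurable_lintegral_subGrMeasure_rotate {k m : ℕ} (hkm : k ≤ m) (η : Gr V m)
    {F : Gr V k → ℝ≥0∞} (hF : Measurable F) :
    Measurable fun g => ∫⁻ ξ, F ξ ∂(subGrMeasure k (Gr.rotate g η)) := by
  have := isProbabilityMeasure_subGrMeasure hkm η
  simp_rw [subGrMeasure_rotate hkm, lintegral_map hF (measurable_rotate_right _)]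
  exact (hF.comp (Gr.measurable_rotate k)).lintegral_prod_right'

/-- The continuous image of a measure that is inner regular for compact sets is as complete as the
measure itself: no measurability of the predicate is needed. -/
theorem ae_map_of_ae_of_continuous {X Y : Type*} [TopologicalSpace X] [MeasurableSpace X]
    [BorelSpace X] [TopologicalSpace Y] [T2Space Y] [MeasurableSpace Y] [BorelSpace Y]
    {μ : Measure X} [IsFiniteMeasure μ] [μ.InnerRegularCompactLTTop] {φ : X → Y}
    (hφ : Continuous φ) {p : Y → Prop} (hp : ∀ᵐ x ∂μ, p (φ x)) : ∀ᵐ y ∂(μ.map φ), p y := by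
  let N := toMeasurable μ {x | p (φ x)}ᶜ
  have hN : μ N = 0 := (measure_toMeasurable _).trans hp
  have hNm : MeasurableSet N := measurableSet_toMeasurable _ _
  -- Compact sets of good points exhaust the measure. Their images are compact, hence closed, so the
  -- union of the images is a measurable set of full measure on which p holds.
  have key : ∀ j : ℕ, ∃ K ⊆ Nᶜ, IsCompact K ∧ μ univ < μ K + ((j : ℝ≥0∞) + 1)⁻¹ := fun j => by
    obtain ⟨K, hK, hKc, hlt⟩ := hNm.compl.exists_isCompact_lt_add (μ := μ) (measure_ne_top _ _)
      (ε := ((j : ℝ≥0∞) + 1)⁻¹) (by simp)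
    refine ⟨K, hK, hKc, ?_⟩
    rwa [measure_congr (show (Nᶜ : Set X) =ᵐ[μ] univ from
      ae_eq_univ.2 (by rwa [compl_compl]))] at hlt
  choose K hKN hKc hKlt using key
  have hm : MeasurableSet (⋃ j, φ '' K j) :=
    .iUnion fun j => ((hKc j).image hφ).isClosed.measurableSet
  have hfull : ∀ᵐ y ∂(μ.map φ), y ∈ ⋃ j, φ '' K j := by
    refine (ae_map_iff hφ.measurable.aemeasurable hm).2 ?_
    have hsub : (φ ⁻¹' (⋃ j, φ '' K j))ᶜ ⊆ (⋃ j, φ ⁻¹' (φ '' K j))ᶜ := by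
      rw [preimage_iUnion]
    refine measure_mono_null hsub (le_antisymm ?_ bot_le)
    refine ENNReal.le_of_forall_pos_le_add fun ε hε _ => ?_
    rw [zero_add]
    obtain ⟨j, hj⟩ := ENNReal.exists_inv_nat_lt (a := (ε : ℝ≥0∞)) (by simpa using hε.ne')
    have hKm : MeasurableSet (φ ⁻¹' (φ '' K j)) :=
      hφ.measurable ((hKc j).image hφ).isClosed.measurableSet
    calc μ (⋃ j, φ ⁻¹' (φ '' K j))ᶜ ≤ μ (φ ⁻¹' (φ '' K j))ᶜ :=
          measure_mono (compl_subset_compl.2 (subset_iUnion (fun j => φ ⁻¹' (φ '' K j)) j))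
      _ = μ univ - μ (φ ⁻¹' (φ '' K j)) := measure_compl hKm (measure_ne_top _ _)
      _ ≤ μ univ - μ (K j) := by
          gcongr
          exact subset_preimage_image _ _
      _ ≤ ((j : ℝ≥0∞) + 1)⁻¹ := tsub_le_iff_left.2 (hKlt j).le
      _ ≤ (j : ℝ≥0∞)⁻¹ := by
          gcongr
          exact le_self_add
      _ ≤ ε := hj.le
  filter_upwards [hfull] with y hy
  obtain ⟨j, x, hx, rfl⟩ := mem_iUnion.1 hy
  by_contra hcon
  exact hKN j hx (subset_toMeasurable μ _ hcon)

theorem ae_grMeasure_of_ae_rotate {m : ℕ} (η : Gr V m) {p : Gr V m → Prop}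
    (h : ∀ᵐ g ∂(orthHaar V), p (Gr.rotate g η)) : ∀ᵐ ζ ∂(grMeasure V m), p ζ := by
  rw [grMeasure_eq_map η]
  exact ae_map_of_ae_of_continuous
    ((Gr.continuous_rotate m).comp (by fun_prop : Continuous fun g : OrthGroup V => (g, η))) h

theorem ae_lintegral_subGrMeasure_lt_top {k m : ℕ} (hkm : k ≤ m) {F : Gr V k → ℝ≥0∞}
    (hF : Measurable F) (hfin : ∫⁻ ξ, F ξ ∂(grMeasure V k) ≠ ∞) :
    ∀ᵐ η ∂(grMeasure V m), ∫⁻ ξ, F ξ ∂(subGrMeasure k η) < ∞ := by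
  by_cases hne : Nonempty (Gr V m)
  · obtain ⟨η⟩ := hne
    refine ae_grMeasure_of_ae_rotate η (ae_lt_top
      (measurable_lintegral_subGrMeasure_rotate hkm η hF) ?_)
    rwa [lintegral_lintegral_subGrMeasure_rotate hkm η hF]
  · simp [grMeasure, hne]

/-- The disintegration formula is applied to the indicator of a measurable null set containing the
exceptional ξ. -/
theorem ae_ae_subGrMeasure {k m : ℕ} (hkm : k ≤ m) {p : Gr V k → Prop}
    (hp : ∀ᵐ ξ ∂(grMeasure V k), p ξ) :
    ∀ᵐ η ∂(grMeasure V m), ∀ᵐ ξ ∂(subGrMeasure k η), p ξ := by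
  obtain ⟨N, hpN, hN, hN0⟩ := exists_measurable_superset_of_null hp
  by_cases hne : Nonempty (Gr V m)
  · obtain ⟨η⟩ := hne
    refine ae_grMeasure_of_ae_rotate η ?_
    have hF : Measurable (N.indicator (1 : Gr V k → ℝ≥0∞)) := measurable_one.indicator hN
    have h0 := lintegral_lintegral_subGrMeasure_rotate hkm η hF
    rw [lintegral_indicator_one hN, hN0,
      lintegral_eq_zero_iff (measurable_lintegral_subGrMeasure_rotate hkm η hF)] at h0
    filter_upwards [h0] with g hg
    rw [lintegral_indicator_one hN] at hg
    exact measure_mono_null hpN hg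
  · simp [grMeasure, hne]

end Action

/-! ### Integrals of radial functions -/

section Radial

theorem sphereArea_pos {d : ℕ} (hd : d ≠ 0) : 0 < sphereArea d := by
  have : 0 < (d : ℝ) / 2 := by positivity
  have := Real.Gamma_pos_of_pos this
  have := Real.pi_pos
  unfold sphereArea
  positivity

variable {E : Type*} [NormedAddCommGroup E] [InnerProductSpace ℝ E] [FiniteDimensional ℝ E]
  [MeasurableSpace E] [BorelSpace E] [Nontrivial E]

theorem finrank_mul_volume_ball_eq_sphereArea :
    (Module.finrank ℝ E : ℝ) * (volume : Measure E).real (Metric.ball 0 1) =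
      sphereArea (Module.finrank ℝ E) := by
  have hd : (0 : ℝ) < Module.finrank ℝ E := by exact_mod_cast Module.finrank_pos
  have hG := Real.Gamma_pos_of_pos (half_pos hd)
  rw [Measure.real, InnerProductSpace.volume_ball, ENNReal.ofReal_one, one_pow, one_mul,
    ENNReal.toReal_ofReal (by positivity), Real.Gamma_add_one (by positivity), sphereArea,
    Real.sqrt_eq_rpow, ← Real.rpow_mul_natCast Real.pi_pos.le]
  rw [show (1 / 2 * (Module.finrank ℝ E : ℝ)) = (Module.finrank ℝ E : ℝ) / 2 by ring]
  field_simp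

theorem image_sqrt_sq_sub_sq {s : ℝ} (hs : 0 ≤ s) :
    (fun r : ℝ => √(r ^ 2 - s ^ 2)) '' Ioi s = Ioi 0 := by
  ext ρ
  constructor
  · rintro ⟨r, hr, rfl⟩
    have : s < r := hr
    exact Real.sqrt_pos.2 (by nlinarith)
  · intro hρ
    have hρ : 0 < ρ := hρ
    refine ⟨√(s ^ 2 + ρ ^ 2), Real.lt_sqrt_of_sq_lt (by nlinarith), ?_⟩
    simp only
    rw [Real.sq_sqrt (by positivity), add_sub_cancel_left, Real.sqrt_sq hρ.le]

theorem injOn_sqrt_sq_sub_sq {s : ℝ} (hs : 0 ≤ s) :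
    InjOn (fun r : ℝ => √(r ^ 2 - s ^ 2)) (Ioi s) := by
  intro r hr t ht h
  have hr : s < r := hr
  have ht : s < t := ht
  have h := (Real.sqrt_inj (by nlinarith) (by nlinarith)).1 h
  have : r ^ 2 = t ^ 2 := by linarith
  exact (pow_left_inj₀ (by linarith) (by linarith) two_ne_zero).1 this

theorem hasDerivAt_sqrt_sq_sub_sq {s r : ℝ} (hs : 0 ≤ s) (hr : s < r) :
    HasDerivAt (fun r : ℝ => √(r ^ 2 - s ^ 2)) (r / √(r ^ 2 - s ^ 2)) r := by
  have h0 : r ^ 2 - s ^ 2 ≠ 0 := by nlinarith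
  convert ((hasDerivAt_pow 2 r).sub_const (s ^ 2)).sqrt h0 using 1
  simp
  field_simp

/-- With ρ = √(r² - s²), this is the identity ρ^(d-1) dρ = (r² - s²)^(d/2-1) r dr. -/
theorem jacobian_radial {F : Type*} [NormedAddCommGroup F] [NormedSpace ℝ F] {d : ℕ} (hd : d ≠ 0)
    (h : ℝ → F) {s r : ℝ} (hs : 0 ≤ s) (hr : s < r) :
    |r / √(r ^ 2 - s ^ 2)| • (√(r ^ 2 - s ^ 2) ^ (d - 1) • h √(s ^ 2 + √(r ^ 2 - s ^ 2) ^ 2)) =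
      ((r ^ 2 - s ^ 2) ^ ((d : ℝ) / 2 - 1) * r) • h r := by
  have hr0 : 0 < r := hs.trans_lt hr
  have h0 : 0 < r ^ 2 - s ^ 2 := by nlinarith
  rw [Real.sq_sqrt h0.le, add_sub_cancel, Real.sqrt_sq hr0.le, smul_smul,
    abs_of_nonneg (by positivity)]
  congr 1
  rw [Real.sqrt_eq_rpow, ← Real.rpow_mul_natCast h0.le, div_eq_mul_inv, ← Real.rpow_neg h0.le,
    mul_assoc, ← Real.rpow_add h0, mul_comm, Nat.cast_sub (Nat.one_le_iff_ne_zero.2 hd)]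
  congr 2
  push_cast
  ring

/-- Polar coordinates and the bijection r ↦ √(r² - s²) from (s, ∞) onto (0, ∞) both preserve
integrability in either direction, so h need not be measurable. -/
theorem integrable_radial_iff {F : Type*} [NormedAddCommGroup F] [NormedSpace ℝ F] {d : ℕ}
    (hd : Module.finrank ℝ E = d) (h : ℝ → F) {s : ℝ} (hs : 0 ≤ s) :
    Integrable (fun x : E => h √(s ^ 2 + ‖x‖ ^ 2)) ↔
      IntegrableOn (fun r : ℝ => ((r ^ 2 - s ^ 2) ^ ((d : ℝ) / 2 - 1) * r) • h r) (Ioi s) := by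
  have hd0 : d ≠ 0 := hd ▸ Module.finrank_pos.ne'
  rw [integrable_fun_norm_addHaar volume (f := fun ρ => h √(s ^ 2 + ρ ^ 2)), hd,
    ← image_sqrt_sq_sub_sq hs, integrableOn_image_iff_integrableOn_abs_deriv_smul measurableSet_Ioi
      (fun r hr => (hasDerivAt_sqrt_sq_sub_sq hs hr).hasDerivWithinAt) (injOn_sqrt_sq_sub_sq hs)]
  exact integrableOn_congr_fun (fun r hr => jacobian_radial hd0 h hs hr) measurableSet_Ioi

theorem integral_radial {F : Type*} [NormedAddCommGroup F] [NormedSpace ℝ F] {d : ℕ}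
    (hd : Module.finrank ℝ E = d) (h : ℝ → F) {s : ℝ} (hs : 0 ≤ s) :
    ∫ x : E, h √(s ^ 2 + ‖x‖ ^ 2) = sphereArea d •
      ∫ r in Ioi s, ((r ^ 2 - s ^ 2) ^ ((d : ℝ) / 2 - 1) * r) • h r := by
  have hd0 : d ≠ 0 := hd ▸ Module.finrank_pos.ne'
  rw [integral_fun_norm_addHaar volume (fun ρ => h √(s ^ 2 + ρ ^ 2)), ← Nat.cast_smul_eq_nsmul ℝ,
    smul_smul, finrank_mul_volume_ball_eq_sphereArea, hd,
    ← image_sqrt_sq_sub_sq hs, integral_image_eq_integral_abs_deriv_smul measurableSet_Ioi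
      (fun r hr => (hasDerivAt_sqrt_sq_sub_sq hs hr).hasDerivWithinAt) (injOn_sqrt_sq_sub_sq hs)]
  congr 1
  exact setIntegral_congr_fun measurableSet_Ioi fun r hr => jacobian_radial hd0 h hs hr

theorem ae_norm_of_ae {p : ℝ → Prop} (hp : ∀ᵐ s ∂(volume.restrict (Ioi (0 : ℝ))), p s) :
    ∀ᵐ x : E, p ‖x‖ := by
  obtain ⟨N, hpN, hN, hN0⟩ := exists_measurable_superset_of_null hp
  -- The integral of this indicator at ‖x‖ vanishes by polar coordinates, which shows that the
  -- points with radius in N form a null set.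
  let f : ℝ → ℝ := N.indicator 1
  have hf : ∀ᵐ y ∂(volume.restrict (Ioi (0 : ℝ))),
      y ^ (Module.finrank ℝ E - 1) • f y = (fun _ => (0 : ℝ)) y := by
    filter_upwards [compl_mem_ae_iff.2 hN0] with y hy
    simp [f, indicator_of_notMem hy]
  have hi : Integrable (fun x : E => f ‖x‖) := by
    rw [integrable_fun_norm_addHaar volume, IntegrableOn, integrable_congr hf]
    exact integrable_zero _ _ _
  have h0 : ∫ x : E, f ‖x‖ = 0 := by
    rw [integral_fun_norm_addHaar, integral_congr_ae hf]
    simp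
  rw [integral_eq_zero_iff_of_nonneg (fun x => indicator_nonneg (by simp) _) hi] at h0
  filter_upwards [h0] with x hx
  by_contra hcon
  have : ‖x‖ ∈ N := hpN hcon
  simp [indicator_of_mem this] at hx

end Radial

/-! ### An estimate for the Abel-type kernel -/

section Kernel

/-- The weight s⁻² gives the singular kernel an elementary antiderivative; it vanishes at s = r and
is at least -1/a at s = a. -/
theorem hasDerivAt_sqrt_div {r s : ℝ} (hs : 0 < s) (hsr : s < r) :
    HasDerivAt (fun s : ℝ => -(√(r ^ 2 - s ^ 2) / (r * s))) (r / √(r ^ 2 - s ^ 2) / s ^ 2) s := by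
  have hr : 0 < r := hs.trans hsr
  have h0 : 0 < r ^ 2 - s ^ 2 := by nlinarith
  have hq := Real.sqrt_pos.2 h0
  have h1 := ((hasDerivAt_pow 2 s).const_sub (r ^ 2)).sqrt h0.ne'
  have h2 : HasDerivAt (fun s : ℝ => -(√(r ^ 2 - s ^ 2) / (r * s))) _ s :=
    (h1.div (hasDerivAt_const_mul r) (by positivity)).neg
  convert h2 using 1
  simp
  field_simp
  rw [Real.sq_sqrt h0.le]
  ring

theorem setLIntegral_kernel_le {a r : ℝ} (ha : 0 < a) (har : a < r) :
    ∫⁻ s in Ioo a r, ENNReal.ofReal (r / √(r ^ 2 - s ^ 2) / s ^ 2) ≤ ENNReal.ofReal (1 / a) := by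
  have hr : 0 < r := ha.trans har
  have hcont : ContinuousOn (fun s : ℝ => -(√(r ^ 2 - s ^ 2) / (r * s))) (Icc a r) := by
    apply ContinuousOn.neg
    apply ContinuousOn.div (by fun_prop) (by fun_prop)
    intro s hs
    have := ha.trans_le hs.1
    positivity
  have hder : ∀ s ∈ Ioo a r, HasDerivAt (fun s : ℝ => -(√(r ^ 2 - s ^ 2) / (r * s)))
      (r / √(r ^ 2 - s ^ 2) / s ^ 2) s := fun s hs => hasDerivAt_sqrt_div (ha.trans hs.1) hs.2
  have hi := intervalIntegral.integrableOn_deriv_of_nonneg hcont hder fun s hs => by positivity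
  have heq := intervalIntegral.integral_eq_sub_of_hasDerivAt_of_le har.le hcont hder
    ((intervalIntegrable_iff_integrableOn_Ioc_of_le har.le).2 hi)
  rw [Measure.restrict_congr_set Ioo_ae_eq_Ioc, ← ofReal_integral_eq_lintegral_ofReal hi
    (.of_forall fun s => by positivity), ← intervalIntegral.integral_of_le har.le, heq]
  apply ENNReal.ofReal_le_ofReal
  simp only [sub_self, Real.sqrt_zero, zero_div, neg_zero, zero_sub, neg_neg]
  rw [div_le_div_iff₀ (by positivity) ha, one_mul]
  gcongr
  exact Real.sqrt_le_iff.2 ⟨hr.le, by nlinarith⟩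

/-- The left side is √(r² - s²)^(d-1) · r/√(r² - s²), and the root is at most r. This treats d = 1,
where the exponent is negative, together with all larger d. -/
theorem kernel_le {d : ℕ} (hd : d ≠ 0) {r s : ℝ} (hs : 0 < s) (hsr : s < r) :
    (r ^ 2 - s ^ 2) ^ ((d : ℝ) / 2 - 1) * r ≤ r ^ (d - 1) * (r / √(r ^ 2 - s ^ 2)) := by
  have hr : 0 < r := hs.trans hsr
  have h0 : 0 < r ^ 2 - s ^ 2 := by nlinarith
  have h := jacobian_radial hd (fun _ => (1 : ℝ)) hs.le hsr
  rw [smul_eq_mul, smul_eq_mul, smul_eq_mul, mul_one, mul_one, abs_of_nonneg (by positivity)] at h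
  rw [← h, mul_comm]
  gcongr
  exact Real.sqrt_le_iff.2 ⟨hr.le, by nlinarith⟩

/-- The Abel-type transform of a function that is integrable at infinity exists for almost
all `s`. -/
theorem ae_lintegral_lintegral_kernel_lt_top {X : Type*} [MeasurableSpace X] (ν : Measure X)
    [SFinite ν] {F : X → ℝ → ℝ≥0∞} (hF : Measurable (Function.uncurry F)) {d : ℕ} (hd : d ≠ 0)
    {a : ℝ} (ha : 0 < a)
    (hfin : ∫⁻ x, (∫⁻ r in Ioi a, F x r * ENNReal.ofReal (r ^ (d - 1))) ∂ν < ∞) :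
    ∀ᵐ s ∂(volume.restrict (Ioi a)),
      ∫⁻ x, (∫⁻ r in Ioi s, F x r * ENNReal.ofReal ((r ^ 2 - s ^ 2) ^ ((d : ℝ) / 2 - 1) * r)) ∂ν
        < ∞ := by
  -- Extending the kernel by zero to r ≤ s removes s from the domain of integration, so that Tonelli
  -- applies on a product.
  let k : ℝ → ℝ → ℝ≥0∞ := fun s r =>
    (Ioi s).indicator (fun r => ENNReal.ofReal ((r ^ 2 - s ^ 2) ^ ((d : ℝ) / 2 - 1) * r)) r
  have hk : Measurable (Function.uncurry k) := by
    have : Function.uncurry k = {q : ℝ × ℝ | q.1 < q.2}.indicator fun q =>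
        ENNReal.ofReal ((q.2 ^ 2 - q.1 ^ 2) ^ ((d : ℝ) / 2 - 1) * q.2) := by
      ext ⟨s, r⟩
      simp [k, indicator]
    rw [this]
    exact Measurable.indicator (by fun_prop) (measurableSet_lt measurable_fst measurable_snd)
  have hFk : Measurable fun q : ℝ × X × ℝ => F q.2.1 q.2.2 * k q.1 q.2.2 :=
    (hF.comp (by fun_prop : Measurable fun q : ℝ × X × ℝ => (q.2.1, q.2.2))).mul
      (hk.comp (by fun_prop : Measurable fun q : ℝ × X × ℝ => (q.1, q.2.2)))
  let K : ℝ → ℝ≥0∞ := fun s => ∫⁻ p, F p.1 p.2 * k s p.2 ∂(ν.prod volume)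
  have hK : Measurable K := hFk.lintegral_prod_right'
  have hKeq : ∀ s, K s = ∫⁻ x, (∫⁻ r in Ioi s,
      F x r * ENNReal.ofReal ((r ^ 2 - s ^ 2) ^ ((d : ℝ) / 2 - 1) * r)) ∂ν := by
    intro s
    rw [show K s = ∫⁻ x, (∫⁻ r, F x r * k s r) ∂ν from
      lintegral_prod _ (hFk.comp measurable_prodMk_left).aemeasurable]
    refine lintegral_congr fun x => ?_
    rw [← lintegral_indicator measurableSet_Ioi]
    refine lintegral_congr fun r => ?_
    by_cases h : r ∈ Ioi s <;> simp [k, h]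
  have hw : Measurable fun s : ℝ => ENNReal.ofReal (1 / s ^ 2) := by fun_prop
  have hbound : ∀ r, ∫⁻ s in Ioi a, k s r * ENNReal.ofReal (1 / s ^ 2) ≤
      (Ioi a).indicator (fun r => ENNReal.ofReal (r ^ (d - 1)) * ENNReal.ofReal (1 / a)) r := by
    intro r
    by_cases har : a < r
    · rw [indicator_of_mem (mem_Ioi.2 har)]
      calc ∫⁻ s in Ioi a, k s r * ENNReal.ofReal (1 / s ^ 2)
          ≤ ∫⁻ s in Ioi a, (Ioo a r).indicator (fun s => ENNReal.ofReal (r ^ (d - 1)) *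
              ENNReal.ofReal (r / √(r ^ 2 - s ^ 2) / s ^ 2)) s := by
            refine setLIntegral_mono' measurableSet_Ioi fun s hs => ?_
            have hs0 : 0 < s := ha.trans hs
            have hr0 : 0 < r := ha.trans har
            by_cases hsr : s < r
            · rw [indicator_of_mem (show s ∈ Ioo a r from ⟨hs, hsr⟩)]
              simp only [k]
              rw [indicator_of_mem (mem_Ioi.2 hsr), ← ENNReal.ofReal_mul' (by positivity),
                ← ENNReal.ofReal_mul' (by positivity)]
              apply ENNReal.ofReal_le_ofReal
              calc _ ≤ r ^ (d - 1) * (r / √(r ^ 2 - s ^ 2)) * (1 / s ^ 2) :=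
                    mul_le_mul_of_nonneg_right (kernel_le hd hs0 hsr) (by positivity)
                _ = _ := by ring
            · simp [k, hsr]
        _ ≤ ∫⁻ s, (Ioo a r).indicator (fun s => ENNReal.ofReal (r ^ (d - 1)) *
              ENNReal.ofReal (r / √(r ^ 2 - s ^ 2) / s ^ 2)) s := setLIntegral_le_lintegral _ _
        _ = ENNReal.ofReal (r ^ (d - 1)) *
              ∫⁻ s in Ioo a r, ENNReal.ofReal (r / √(r ^ 2 - s ^ 2) / s ^ 2) := by
            rw [lintegral_indicator measurableSet_Ioo,
              lintegral_const_mul' _ _ ENNReal.ofReal_ne_top]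
        _ ≤ _ := by
            gcongr
            exact setLIntegral_kernel_le ha har
    · rw [indicator_of_notMem (by simpa using har)]
      refine (setLIntegral_mono' (g := fun _ => 0) measurableSet_Ioi fun s hs => ?_).trans (by simp)
      have : ¬ s < r := fun h => har ((mem_Ioi.1 hs).trans h)
      simp [k, this]
  have hfinal : ∫⁻ s in Ioi a, K s * ENNReal.ofReal (1 / s ^ 2) ≠ ∞ := by
    refine ne_top_of_le_ne_top
      (b := (∫⁻ x, (∫⁻ r in Ioi a, F x r * ENNReal.ofReal (r ^ (d - 1))) ∂ν) *
        ENNReal.ofReal (1 / a)) (ENNReal.mul_ne_top hfin.ne ENNReal.ofReal_ne_top) ?_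
    calc ∫⁻ s in Ioi a, K s * ENNReal.ofReal (1 / s ^ 2)
        = ∫⁻ s in Ioi a, ∫⁻ p, F p.1 p.2 * k s p.2 * ENNReal.ofReal (1 / s ^ 2)
            ∂(ν.prod volume) := by
          refine lintegral_congr fun s => ?_
          rw [← lintegral_mul_const' _ _ ENNReal.ofReal_ne_top]
      _ = ∫⁻ p, (∫⁻ s in Ioi a, F p.1 p.2 * k s p.2 * ENNReal.ofReal (1 / s ^ 2))
            ∂(ν.prod volume) :=
          lintegral_lintegral_swap (hFk.mul (hw.comp measurable_fst)).aemeasurable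
      _ = ∫⁻ p, F p.1 p.2 * (∫⁻ s in Ioi a, k s p.2 * ENNReal.ofReal (1 / s ^ 2))
            ∂(ν.prod volume) := by
          refine lintegral_congr fun p => ?_
          simp_rw [mul_assoc]
          exact lintegral_const_mul _
            ((hk.comp (by fun_prop : Measurable fun s : ℝ => (s, p.2))).mul hw)
      _ ≤ ∫⁻ p, F p.1 p.2 * (Ioi a).indicator (fun r => ENNReal.ofReal (r ^ (d - 1)) *
            ENNReal.ofReal (1 / a)) p.2 ∂(ν.prod volume) := by
          gcongr with p
          exact hbound p.2
      _ = ∫⁻ x, (∫⁻ r, F x r * (Ioi a).indicator (fun r => ENNReal.ofReal (r ^ (d - 1)) *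
            ENNReal.ofReal (1 / a)) r) ∂ν := by
          refine lintegral_prod _ (Measurable.aemeasurable (hF.mul ?_))
          exact (Measurable.indicator (by fun_prop) measurableSet_Ioi).comp measurable_snd
      _ = ∫⁻ x, (∫⁻ r in Ioi a, F x r * ENNReal.ofReal (r ^ (d - 1))) *
            ENNReal.ofReal (1 / a) ∂ν := by
          refine lintegral_congr fun x => ?_
          rw [← lintegral_mul_const' _ _ ENNReal.ofReal_ne_top,
            ← lintegral_indicator measurableSet_Ioi]
          refine lintegral_congr fun r => ?_
          by_cases h : r ∈ Ioi a <;> simp [h, mul_assoc]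
      _ = _ := lintegral_mul_const' _ _ ENNReal.ofReal_ne_top
  have hae := ae_lt_top (hK.mul hw) hfinal
  filter_upwards [hae, ae_restrict_mem measurableSet_Ioi] with s hs hsa
  rw [← hKeq]
  by_contra hcon
  rw [not_lt, top_le_iff] at hcon
  have hpos : 0 < s := ha.trans hsa
  -- Finiteness is known only for the weighted quantity; since the weight is nonzero, it passes to
  -- the integral itself.
  have hw0 : ENNReal.ofReal (1 / s ^ 2) ≠ 0 := by
    rw [Ne, ENNReal.ofReal_eq_zero, not_le]
    positivity
  simp only [Pi.mul_apply, hcon, ENNReal.top_mul hw0, lt_irrefl] at hs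

end Kernel

/-! ### Reduction of the Radon transform to a one-dimensional integral -/

section Reduction

variable {V : Type*} [NormedAddCommGroup V] [InnerProductSpace ℝ V]

theorem AffGr.dir_mk {m : ℕ} (η : Gr V m) (v : V) : (AffGr.mk η v).dir = η :=
  Subtype.ext (AffineSubspace.direction_mk' v η.1)

theorem radialIntegrand_eq_smul {k : ℕ} (d : ℕ) (f₀ : Gr V k → ℝ → ℂ) (s : ℝ) (ξ : Gr V k) (r : ℝ) :
    radialIntegrand d f₀ s ξ r = ((r ^ 2 - s ^ 2) ^ ((d : ℝ) / 2 - 1) * r) • f₀ ξ r := by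
  rw [radialIntegrand, Complex.real_smul, mul_comm]

theorem norm_radialIntegrand {k : ℕ} (d : ℕ) (f₀ : Gr V k → ℝ → ℂ) {s r : ℝ} (hs : 0 ≤ s) (hr : s < r)
    (ξ : Gr V k) :
    ‖radialIntegrand d f₀ s ξ r‖ = ((r ^ 2 - s ^ 2) ^ ((d : ℝ) / 2 - 1) * r) • ‖f₀ ξ r‖ := by
  have h0 : 0 ≤ r ^ 2 - s ^ 2 := by nlinarith
  have hr0 : 0 ≤ r := hs.trans hr.le
  rw [radialIntegrand_eq_smul, norm_smul, Real.norm_of_nonneg (by positivity), smul_eq_mul]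

theorem norm_add_of_mem_orthogonal {m : ℕ} {η : Gr V m} {v : V}
    (hv : v ∈ Submodule.orthogonal η.1) {x : V} (hx : x ∈ η.1) :
    ‖v + x‖ = √(‖v‖ ^ 2 + ‖x‖ ^ 2) := by
  have h := norm_add_sq_eq_norm_sq_add_norm_sq_of_inner_eq_zero v x
    (Submodule.inner_left_of_mem_orthogonal hx hv)
  rw [eq_comm, Real.sqrt_eq_iff_mul_self_eq (by positivity) (norm_nonneg _), h]
  ring

/-- Since η^⊥ ⊂ ξ^⊥, the vector v + x lies in ξ^⊥, where the profile applies, and its norm is given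
by Pythagoras. -/
theorem HasRadialProfile.apply_mk_add {k m : ℕ} {f : AffGr V k → ℂ}
    {f₀ : Gr V k → ℝ → ℂ} (hf : HasRadialProfile f f₀) {ξ : Gr V k} {η : Gr V m}
    (h : ξ.1 ≤ η.1) {v : V} (hv : v ∈ Submodule.orthogonal η.1)
    (x : ↥(Submodule.orthogonal ξ.1 ⊓ η.1)) :
    f (AffGr.mk ξ (v + x)) = f₀ ξ √(‖v‖ ^ 2 + ‖x‖ ^ 2) := by
  rw [hf ξ _ (Submodule.add_mem _ (Submodule.orthogonal_le h hv) x.2.1),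
    norm_add_of_mem_orthogonal hv x.2.2]
  rfl

variable [FiniteDimensional ℝ V]

theorem AffGr.foot_mk {m : ℕ} (η : Gr V m) {v : V} (hv : v ∈ Submodule.orthogonal η.1) :
    (AffGr.mk η v).foot = v := by
  have : Nonempty (AffGr.mk η v).1 := (AffGr.mk η v).2.1.to_subtype
  refine EuclideanGeometry.coe_orthogonalProjection_eq_iff_mem.2 ⟨?_, ?_⟩
  · exact AffineSubspace.self_mem_mk' v η.1
  · rw [show (AffGr.mk η v).1.direction = η.1 from AffineSubspace.direction_mk' v η.1]
    simpa using hv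

theorem finrank_orthogonal_inf {k m : ℕ} {ξ : Gr V k} {η : Gr V m} (h : ξ.1 ≤ η.1) :
    Module.finrank ℝ ↥(Submodule.orthogonal ξ.1 ⊓ η.1) = m - k := by
  have := Submodule.finrank_add_inf_finrank_orthogonal h
  rw [ξ.2, η.2] at this
  omega

variable {k m : ℕ} {f : AffGr V k → ℂ} {f₀ : Gr V k → ℝ → ℂ}

theorem nontrivial_orthogonal_inf (hkm : k < m) {ξ : Gr V k} {η : Gr V m} (h : ξ.1 ≤ η.1) :
    Nontrivial ↥(Submodule.orthogonal ξ.1 ⊓ η.1) :=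
  Module.nontrivial_of_finrank_pos (R := ℝ) (by rw [finrank_orthogonal_inf h]; omega)

variable [MeasurableSpace V] [BorelSpace V]

theorem HasRadialProfile.integrable_iff (hf : HasRadialProfile f f₀) (hkm : k < m) {ξ : Gr V k}
    {η : Gr V m} (h : ξ.1 ≤ η.1) {v : V} (hv : v ∈ Submodule.orthogonal η.1) :
    Integrable (fun x : ↥(Submodule.orthogonal ξ.1 ⊓ η.1) => f (AffGr.mk ξ (v + x))) ↔
      IntegrableOn (radialIntegrand (m - k) f₀ ‖v‖ ξ) (Ioi ‖v‖) := by
  have := nontrivial_orthogonal_inf hkm h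
  simp_rw [hf.apply_mk_add h hv]
  rw [integrable_radial_iff (finrank_orthogonal_inf h) _ (norm_nonneg v)]
  simp only [← radialIntegrand_eq_smul]

theorem HasRadialProfile.integral_eq (hf : HasRadialProfile f f₀) (hkm : k < m) {ξ : Gr V k}
    {η : Gr V m} (h : ξ.1 ≤ η.1) {v : V} (hv : v ∈ Submodule.orthogonal η.1) :
    ∫ x : ↥(Submodule.orthogonal ξ.1 ⊓ η.1), f (AffGr.mk ξ (v + x)) =
      radialTransform (m - k) f₀ ‖v‖ ξ := by
  have := nontrivial_orthogonal_inf hkm h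
  simp_rw [hf.apply_mk_add h hv]
  rw [integral_radial (finrank_orthogonal_inf h) _ (norm_nonneg v), radialTransform,
    Complex.real_smul]
  simp only [← radialIntegrand_eq_smul]

theorem HasRadialProfile.integral_norm_eq (hf : HasRadialProfile f f₀) (hkm : k < m) {ξ : Gr V k}
    {η : Gr V m} (h : ξ.1 ≤ η.1) {v : V} (hv : v ∈ Submodule.orthogonal η.1) :
    ∫ x : ↥(Submodule.orthogonal ξ.1 ⊓ η.1), ‖f (AffGr.mk ξ (v + x))‖ =
      sphereArea (m - k) * ∫ r in Ioi ‖v‖, ‖radialIntegrand (m - k) f₀ ‖v‖ ξ r‖ := by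
  have := nontrivial_orthogonal_inf hkm h
  simp_rw [hf.apply_mk_add h hv]
  rw [integral_radial (finrank_orthogonal_inf h) (fun r => ‖f₀ ξ r‖) (norm_nonneg v), smul_eq_mul]
  congr 1
  exact setIntegral_congr_fun measurableSet_Ioi fun r hr =>
    (norm_radialIntegrand _ _ (norm_nonneg v) hr ξ).symm

theorem radonExists_mk (f : AffGr V k → ℂ) (η : Gr V m) {v : V}
    (hv : v ∈ Submodule.orthogonal η.1) :
    RadonExists f (AffGr.mk η v) ↔ IteratedIntegrable (subGrMeasure k η)
      (fun ξ : Gr V k => (volume : Measure ↥(Submodule.orthogonal ξ.1 ⊓ η.1)))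
      (fun ξ x => f (AffGr.mk ξ (v + (x : V)))) := by
  -- The direction of η + v equals η only propositionally, and the domain of integration depends on
  -- it; generalizing to ζ permits substitution.
  have key : ∀ ζ : Gr V m, ζ = η → (IteratedIntegrable (subGrMeasure k ζ)
      (fun ξ : Gr V k => (volume : Measure ↥(Submodule.orthogonal ξ.1 ⊓ ζ.1)))
      (fun ξ x => f (AffGr.mk ξ (v + (x : V)))) ↔ IteratedIntegrable (subGrMeasure k η)
      (fun ξ : Gr V k => (volume : Measure ↥(Submodule.orthogonal ξ.1 ⊓ η.1)))
      (fun ξ x => f (AffGr.mk ξ (v + (x : V))))) := by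
    rintro _ rfl
    rfl
  rw [RadonExists, AffGr.foot_mk η hv]
  exact key _ (AffGr.dir_mk η v)

theorem radon_mk (f : AffGr V k → ℂ) (η : Gr V m) {v : V} (hv : v ∈ Submodule.orthogonal η.1) :
    radon m f (AffGr.mk η v) = ∫ ξ, (∫ x : ↥(Submodule.orthogonal ξ.1 ⊓ η.1),
      f (AffGr.mk ξ (v + (x : V)))) ∂(subGrMeasure k η) := by
  have key : ∀ ζ : Gr V m, ζ = η → ∫ ξ, (∫ x : ↥(Submodule.orthogonal ξ.1 ⊓ ζ.1),
      f (AffGr.mk ξ (v + (x : V)))) ∂(subGrMeasure k ζ) =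
      ∫ ξ, (∫ x : ↥(Submodule.orthogonal ξ.1 ⊓ η.1),
        f (AffGr.mk ξ (v + (x : V)))) ∂(subGrMeasure k η) := by
    rintro _ rfl
    rfl
  rw [radon, AffGr.foot_mk η hv]
  exact key _ (AffGr.dir_mk η v)

theorem HasRadialProfile.radon_mk (hf : HasRadialProfile f f₀) (hkm : k < m) (η : Gr V m) {v : V}
    (hv : v ∈ Submodule.orthogonal η.1) :
    radon m f (AffGr.mk η v) =
      ∫ ξ, radialTransform (m - k) f₀ ‖v‖ ξ ∂(subGrMeasure k η) := by
  rw [_root_.radon_mk f η hv]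
  refine integral_congr_ae ?_
  filter_upwards [ae_le_subGrMeasure k η] with ξ h
  exact hf.integral_eq hkm h hv

theorem HasRadialProfile.radonExists_iff (hf : HasRadialProfile f f₀) (hkm : k < m) (η : Gr V m)
    {v : V} (hv : v ∈ Submodule.orthogonal η.1) :
    RadonExists f (AffGr.mk η v) ↔
      IteratedIntegrable (subGrMeasure k η) (fun _ => volume.restrict (Ioi ‖v‖))
        (radialIntegrand (m - k) f₀ ‖v‖) := by
  have hσ : sphereArea (m - k) ≠ 0 := (sphereArea_pos (Nat.sub_ne_zero_of_lt hkm)).ne'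
  have hle := ae_le_subGrMeasure k η
  rw [radonExists_mk f η hv]
  -- The three clauses of `IteratedIntegrable` match separately for almost every ξ, the last two up
  -- to the nonzero factor σ_{d-1}.
  refine and_congr (Filter.eventually_congr ?_) (and_congr ?_ ?_)
  · filter_upwards [hle] with ξ h
    exact hf.integrable_iff hkm h hv
  · rw [integrable_congr (hle.mono fun ξ h => hf.integral_norm_eq hkm h hv)]
    exact integrable_const_mul_iff (isUnit_iff_ne_zero.2 hσ) _
  · rw [aestronglyMeasurable_congr (hle.mono fun ξ h => hf.integral_eq hkm h hv)]
    exact aestronglyMeasurable_const_smul_iff₀ (c := (sphereArea (m - k) : ℂ))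
      (by exact_mod_cast hσ)

end Reduction

/-! ### Existence of the Radon transform -/

section Existence

variable {V : Type*} [NormedAddCommGroup V] [InnerProductSpace ℝ V] [FiniteDimensional ℝ V]
  {k : ℕ}

/-- The profile f₀ itself need not be measurable: f₁ supplies the measurability, and the two agree
for almost every r on ν-almost every ξ. -/
theorem iteratedIntegrable_radialIntegrand (ν : Measure (Gr V k)) [SFinite ν]
    {f₀ f₁ : Gr V k → ℝ → ℂ} (hf₁ : StronglyMeasurable (Function.uncurry f₁))
    (heq : ∀ᵐ ξ ∂ν, f₀ ξ =ᵐ[volume.restrict (Ioi 0)] f₁ ξ) {d : ℕ} {s : ℝ} (hs : 0 ≤ s)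
    (hfin : ∫⁻ ξ, (∫⁻ r in Ioi s, ‖f₁ ξ r‖ₑ *
      ENNReal.ofReal ((r ^ 2 - s ^ 2) ^ ((d : ℝ) / 2 - 1) * r)) ∂ν < ∞) :
    IteratedIntegrable ν (fun _ => volume.restrict (Ioi s)) (radialIntegrand d f₀ s) := by
  have hG : StronglyMeasurable (Function.uncurry (radialIntegrand d f₁ s)) := by
    refine hf₁.mul (Measurable.stronglyMeasurable ?_)
    fun_prop
  have heq' : ∀ᵐ ξ ∂ν,
      radialIntegrand d f₀ s ξ =ᵐ[volume.restrict (Ioi s)] radialIntegrand d f₁ s ξ := by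
    filter_upwards [heq] with ξ h
    filter_upwards [ae_restrict_of_ae_restrict_of_subset (Ioi_subset_Ioi hs) h] with r hr
    simp only [radialIntegrand, hr]
  have hnorm : ∀ ξ, ∫⁻ r in Ioi s, ‖radialIntegrand d f₁ s ξ r‖ₑ =
      ∫⁻ r in Ioi s, ‖f₁ ξ r‖ₑ * ENNReal.ofReal ((r ^ 2 - s ^ 2) ^ ((d : ℝ) / 2 - 1) * r) := by
    intro ξ
    refine setLIntegral_congr_fun measurableSet_Ioi fun r hr => ?_
    have hr : s < r := hr
    have h0 : 0 ≤ r ^ 2 - s ^ 2 := by nlinarith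
    have hr0 : 0 ≤ r := hs.trans hr.le
    rw [radialIntegrand_eq_smul, enorm_smul, Real.enorm_of_nonneg (by positivity), mul_comm]
  simp_rw [← hnorm] at hfin
  have hG' : Measurable fun ξ => ∫⁻ r in Ioi s, ‖radialIntegrand d f₁ s ξ r‖ₑ :=
    hG.enorm.lintegral_prod_right'
  refine ⟨?_, ?_, ?_⟩
  · filter_upwards [heq', ae_lt_top hG' hfin.ne] with ξ h hξ
    rw [integrable_congr h]
    exact ⟨(hG.comp_measurable measurable_prodMk_left).aestronglyMeasurable, hξ⟩
  · have hc : (fun ξ => ∫ r in Ioi s, ‖radialIntegrand d f₀ s ξ r‖) =ᵐ[ν]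
        fun ξ => ∫ r in Ioi s, ‖radialIntegrand d f₁ s ξ r‖ := by
      filter_upwards [heq'] with ξ h
      exact integral_congr_ae (h.mono fun r hr => congrArg norm hr)
    rw [integrable_congr hc]
    refine ⟨hG.norm.integral_prod_right'.aestronglyMeasurable, ?_⟩
    refine lt_of_le_of_lt (lintegral_mono fun ξ => ?_) hfin
    refine (enorm_integral_le_lintegral_enorm _).trans (le_of_eq ?_)
    simp
  · have hc : (fun ξ => ∫ r in Ioi s, radialIntegrand d f₀ s ξ r) =ᵐ[ν]
        fun ξ => ∫ r in Ioi s, radialIntegrand d f₁ s ξ r := by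
      filter_upwards [heq'] with ξ h
      exact integral_congr_ae h
    rw [aestronglyMeasurable_congr hc]
    exact hG.integral_prod_right'.aestronglyMeasurable

theorem iUnion_Ioi_inv_nat : (⋃ j : ℕ, Ioi (1 / ((j : ℝ) + 1))) = Ioi 0 := by
  ext x
  simp only [mem_iUnion, mem_Ioi]
  exact ⟨fun ⟨j, hj⟩ => lt_trans (by positivity) hj, exists_nat_one_div_lt⟩

theorem ae_ae_iteratedIntegrable_radialIntegrand {m : ℕ} (hkm : k < m) {f₀ : Gr V k → ℝ → ℂ}
    (hmeas : AEStronglyMeasurable (Function.uncurry f₀)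
      ((grMeasure V k).prod (volume.restrict (Ioi (0 : ℝ)))))
    (hint : ∀ a : ℝ, 0 < a →
      ∫⁻ ξ, (∫⁻ r in Ioi a, ‖f₀ ξ r‖ₑ * ENNReal.ofReal (r ^ (m - k - 1))) ∂(grMeasure V k) < ∞) :
    ∀ᵐ η ∂(grMeasure V m), ∀ᵐ s ∂(volume.restrict (Ioi (0 : ℝ))),
      IteratedIntegrable (subGrMeasure k η) (fun _ => volume.restrict (Ioi s))
        (radialIntegrand (m - k) f₀ s) := by
  let f₁ : Gr V k → ℝ → ℂ := Function.curry (hmeas.mk _)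
  have hf₁ : StronglyMeasurable (Function.uncurry f₁) := hmeas.stronglyMeasurable_mk
  have heq : ∀ᵐ ξ ∂(grMeasure V k), f₀ ξ =ᵐ[volume.restrict (Ioi 0)] f₁ ξ :=
    Measure.ae_ae_of_ae_prod hmeas.ae_eq_mk
  have hF : Measurable (Function.uncurry fun ξ r => ‖f₁ ξ r‖ₑ) := hf₁.enorm
  have hH : ∀ a : ℝ, Measurable fun ξ =>
      ∫⁻ r in Ioi a, ‖f₁ ξ r‖ₑ * ENNReal.ofReal (r ^ (m - k - 1)) := fun a =>
    (hF.mul (by fun_prop : Measurable fun p : Gr V k × ℝ =>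
      ENNReal.ofReal (p.2 ^ (m - k - 1)))).lintegral_prod_right'
  have hfin : ∀ a : ℝ, 0 < a → ∫⁻ ξ,
      (∫⁻ r in Ioi a, ‖f₁ ξ r‖ₑ * ENNReal.ofReal (r ^ (m - k - 1))) ∂(grMeasure V k) ≠ ∞ := by
    intro a ha
    refine ne_of_eq_of_ne (lintegral_congr_ae ?_) (hint a ha).ne
    filter_upwards [heq] with ξ h
    refine lintegral_congr_ae ?_
    filter_upwards [ae_restrict_of_ae_restrict_of_subset (Ioi_subset_Ioi ha.le) h] with r hr
    rw [hr]
  -- Only the countably many values a = 1/(j+1) are used, so one null set of η serves them all.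
  have hae : ∀ᵐ η ∂(grMeasure V m), ∀ j : ℕ, ∫⁻ ξ, (∫⁻ r in Ioi (1 / ((j : ℝ) + 1)),
      ‖f₁ ξ r‖ₑ * ENNReal.ofReal (r ^ (m - k - 1))) ∂(subGrMeasure k η) < ∞ :=
    ae_all_iff.2 fun j => ae_lintegral_subGrMeasure_lt_top hkm.le (hH _)
      (hfin _ (by positivity))
  filter_upwards [hae, ae_ae_subGrMeasure hkm.le heq] with η hη hηeq
  have := isProbabilityMeasure_subGrMeasure hkm.le η
  rw [← iUnion_Ioi_inv_nat, ae_restrict_iUnion_iff]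
  intro j
  have hj : (0 : ℝ) < 1 / ((j : ℝ) + 1) := by positivity
  filter_upwards [ae_lintegral_lintegral_kernel_lt_top _ hF (Nat.sub_ne_zero_of_lt hkm) hj (hη j),
    ae_restrict_mem measurableSet_Ioi] with s hs hsj
  exact iteratedIntegrable_radialIntegrand _ hf₁ hηeq (hj.trans hsj).le hs

end Existence

/-! ### The Radon transform of quasi-radial functions. -/

theorem lemma3p2 {n k k' : ℕ} (hk : 1 ≤ k) (hkk' : k < k') (hk'n : k' < n)
    (f : AffGr (EuclideanSpace ℝ (Fin n)) k → ℂ)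
    (f₀ : Gr (EuclideanSpace ℝ (Fin n)) k → ℝ → ℂ) (hf : HasRadialProfile f f₀)
    (hmeas : AEStronglyMeasurable (Function.uncurry f₀)
      ((grMeasure (EuclideanSpace ℝ (Fin n)) k).prod (volume.restrict (Ioi (0 : ℝ)))))
    (hint : ∀ a : ℝ, 0 < a →
      ∫⁻ ξ, (∫⁻ r in Ioi a, ‖f₀ ξ r‖ₑ * ENNReal.ofReal (r ^ (k' - k - 1)))
        ∂(grMeasure (EuclideanSpace ℝ (Fin n)) k) < ∞) :
    -- the integral that defines the Radon transform exists for almost all planes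
    (∀ᵐ η ∂(grMeasure (EuclideanSpace ℝ (Fin n)) k'),
      ∀ᵐ v : ↥(Submodule.orthogonal η.1), RadonExists f (AffGr.mk η v.1)) ∧
    -- the Radon transform is quasi-radial
    QuasiRadial (radon k' f) ∧
    -- its radial profile is given by the explicit formula
    (∀ φ₀ : Gr (EuclideanSpace ℝ (Fin n)) k' → ℝ → ℂ, HasRadialProfile (radon k' f) φ₀ →
      ∀ (η : Gr (EuclideanSpace ℝ (Fin n)) k') (s : ℝ), 0 ≤ s →
        φ₀ η s = ∫ ξ, radialTransform (k' - k) f₀ s ξ ∂(subGrMeasure k η)) ∧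
    -- the integrals on the two sides exist in the Lebesgue sense for the same planes
    (∀ (η : Gr (EuclideanSpace ℝ (Fin n)) k'), ∀ v ∈ Submodule.orthogonal η.1,
      (RadonExists f (AffGr.mk η v) ↔
        IteratedIntegrable (subGrMeasure k η) (fun _ => volume.restrict (Ioi ‖v‖))
          (radialIntegrand (k' - k) f₀ ‖v‖))) := by
  -- Here k' < n enters: a nonzero η^⊥ is needed for polar coordinates in v, and for a vector v of
  -- each prescribed norm s ≥ 0, which determines φ₀(η, s).
  have hperp : ∀ η : Gr (EuclideanSpace ℝ (Fin n)) k',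
      Nontrivial ↥(Submodule.orthogonal η.1) := fun η => by
    refine Module.nontrivial_of_finrank_pos (R := ℝ) ?_
    have := Submodule.finrank_add_finrank_orthogonal η.1
    rw [η.2, finrank_euclideanSpace_fin] at this
    omega
  refine ⟨?_, ⟨fun η s => ∫ ξ, radialTransform (k' - k) f₀ s ξ ∂(subGrMeasure k η),
    fun η v hv => hf.radon_mk hkk' η hv⟩, ?_, fun η v hv => hf.radonExists_iff hkk' η hv⟩
  · filter_upwards [ae_ae_iteratedIntegrable_radialIntegrand hkk' hmeas hint] with η hη
    have := hperp η
    filter_upwards [ae_norm_of_ae (E := ↥(Submodule.orthogonal η.1)) hη] with v hv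
    exact (hf.radonExists_iff hkk' η v.2).2 hv
  · intro φ₀ hφ₀ η s hs
    have := hperp η
    obtain ⟨v, hv⟩ := exists_norm_eq ↥(Submodule.orthogonal η.1) hs
    have hv' : ‖(v : EuclideanSpace ℝ (Fin n))‖ = s := hv
    rw [← hv', ← hφ₀ η v v.2, hf.radon_mk hkk' η v.2]
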